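/- Let $X,Y$ be non-empty compact Hausdorff spaces and let $L$ be a compact Lawson lattice, i.e. a compact Hausdorff distributive topological lattice in which every point has a local base consisting of upper subsemilattices and a local base consisting of lower subsemilattices; let $0,1$ be its bottom and top elements. For a compact Hausdorff space $K$ let $\exp K$ be the space of non-empty closed subsets of $K$ with the Vietoris topology, and $\exp^2K=\exp(\exp K)$. A strict $L$-ambiguous representation between $X$ and $Y$ is a set $R\subset\exp X\times\exp Y\times L$ such that: (a) if $(A,B,\alpha)\in R$, $A'\subset A$, $B\subset B'$, $\alpha'\le\alpha$, then $(A',B',\alpha')\in R$; (b) $(A,B,\alpha),(A,B,\beta)\in R$ implies $(A,B,\alpha\vee\beta)\in R$; (c) $(A,Y,\alpha)\in R$ and $(A,B,0)\in R$ for all $A\in\exp X$, $B\in\exp Y$, $\alpha\in L$; (d) for all $A\in\exp X$ the set $\{(B,\alpha)\mid (A,B,\alpha)\in R\}$ is closed in $\exp Y\times L$; (e) for all $B\in\exp Y$ the set $\{(A,\alpha)\mid (A,B,\alpha)\in R\}$ is closed in $\exp X\times L$. The set $\mathrm{Csamb}_L(X,Y)$ of all such $R$ is ordered by inclusion. For $R\in\mathrm{Csamb}_L(X,Y)$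 put $$R^\cup=\{(\mathcal A,B,\gamma)\in\exp^2X\times\exp Y\times L\mid \gamma\le\sup\{\alpha\in L\mid (A,B,\alpha)\in R\text{ for some }A\in\mathcal A\}\}.$$ For $T\subset\exp^2X\times\exp Y\times L$ let $$T^{\subset}=\{(\mathcal B,B,\beta)\mid\text{there is }(\mathcal A,B,\alpha)\in T\text{ with }\beta\le\alpha\text{ and such that every }A\in\mathcal A\text{ contains some element of }\mathcal B\},$$ let $T^{\sup}$ be the set of all triples $\bigl(\bigcup_{(\mathcal A,B,\alpha)\in F}\mathcal A,\ \bigcup_{(\mathcal A,B,\alpha)\in F}B,\ \sup_{(\mathcal A,B,\alpha)\in F}\alpha\bigr)$, where $F$ is a non-empty closed subset of $\exp^2X\times\exp Y\times L$ contained in $T$, and let $$T^+=\bigl((T\cup\exp^2X\times\{Y\}\times L\cup\exp^2X\times\exp Y\times\{0\})^{\subset}\bigr)^{\sup}.$$ Then: 1. All $R^\cup$ are (non-empty) closed sets, the map $R\mapsto R^\cup$ from $\mathrm{Csamb}_L(X,Y)$ to $\exp(\exp^2X\times\exp Y\times L)$ is injective, and its image is closed. Hence the topology on $\mathrm{Csamb}_L(X,Y)$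 for which this map is an embedding is compact Hausdorff; below $\mathrm{Csamb}_L(X,Y)$ carries this topology. 2. $R\subset S$ if and only if $R^\cup\subset S^\cup$; the partial order on $\mathrm{Csamb}_L(X,Y)$ is closed; and $S$ is the least upper bound of a family $\mathcal R\subset\mathrm{Csamb}_L(X,Y)$ if and only if it is the least upper bound of the closure of $\mathcal R$. 3. Every closed family $\mathcal R\subset\mathrm{Csamb}_L(X,Y)$ has a least upper bound $\sup\mathcal R$ in $\mathrm{Csamb}_L(X,Y)$, determined by $(\sup\mathcal R)^\cup=\bigl(\bigcup_{R\in\mathcal R}R^\cup\bigr)^+$. 4. The map $\mathcal R\mapsto\sup\mathcal R$ from $\exp(\mathrm{Csamb}_L(X,Y))$ to $\mathrm{Csamb}_L(X,Y)$ is continuous. 5. $\mathrm{Csamb}_L(X,Y)$ is a compact Lawson upper semilattice: it is compact Hausdorff, all pairwise joins exist and are continuous, and every point has a local base consisting of upper subsemilattices. -/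

import Mathlib

open Set Topology

namespace AmbRep

universe u v w

/-- The hyperspace `exp X` of non-empty closed subsets of a compact Hausdorff space `X`.  In such a
space the closed subsets are exactly the compact ones, so this is Mathlib's `NonemptyCompacts X`,
whose topology is the Vietoris topology. -/
abbrev Hyp (X : Type u) [TopologicalSpace X] : Type u :=
  TopologicalSpace.NonemptyCompacts X

/-- A (Hausdorff) Lawson upper semilattice: the pairwise join is continuous, and every point has a
local base that consists of upper subsemilattices. -/
structure IsLawsonUpperSemilattice (S : Type u) [TopologicalSpace S] [SemilatticeSup S] :
    Prop where
  t2 : T2Space S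
  continuous_sup : ContinuousSup S
  small : ∀ p : S, ∀ U ∈ 𝓝 p, ∃ V ∈ 𝓝 p, V ⊆ U ∧ SupClosed V

/-- A (Hausdorff) Lawson lattice: a distributive topological lattice in which every point has a
local base of upper subsemilattices and a local base of lower subsemilattices. -/
structure IsLawsonLattice (L : Type u) [TopologicalSpace L] [DistribLattice L] : Prop where
  t2 : T2Space L
  topologicalLattice : TopologicalLattice L
  small_sup : ∀ p : L, ∀ U ∈ 𝓝 p, ∃ V ∈ 𝓝 p, V ⊆ U ∧ SupClosed V
  small_inf : ∀ p : L, ∀ U ∈ 𝓝 p, ∃ V ∈ 𝓝 p, V ⊆ U ∧ InfClosed V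

/-- The set `Csamb_L(X,Y)` of strict `L`-ambiguous representations between the compacta `X` and
`Y`: subsets `R` of `exp X × exp Y × L` with the properties a) -- d) of an `L`-ambiguous
representation (the fields `mono` up to `closed_right`) and strictness (`closed_left`). -/
@[ext]
structure StrictAmb (L : Type w) (X : Type u) (Y : Type v)
    [TopologicalSpace L] [DistribLattice L] [BoundedOrder L]
    [TopologicalSpace X] [TopologicalSpace Y] [CompactSpace Y] [Nonempty Y] where
  carrier : Set (Hyp X × Hyp Y × L)
  mono : ∀ (A A' : Hyp X) (B B' : Hyp Y) (α α' : L), (A' : Set X) ⊆ A → (B : Set Y) ⊆ B' →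
    α' ≤ α → (A, B, α) ∈ carrier → (A', B', α') ∈ carrier
  sup_mem : ∀ (A : Hyp X) (B : Hyp Y) (α β : L), (A, B, α) ∈ carrier → (A, B, β) ∈ carrier →
    (A, B, α ⊔ β) ∈ carrier
  top_mem : ∀ (A : Hyp X) (α : L), (A, ⊤, α) ∈ carrier
  bot_mem : ∀ (A : Hyp X) (B : Hyp Y), (A, B, ⊥) ∈ carrier
  closed_right : ∀ A : Hyp X, IsClosed {p : Hyp Y × L | (A, p.1, p.2) ∈ carrier}
  closed_left : ∀ B : Hyp Y, IsClosed {p : Hyp X × L | (p.1, B, p.2) ∈ carrier}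

section

variable {L : Type w} {X : Type u} {Y : Type v}
  [TopologicalSpace L] [DistribLattice L] [BoundedOrder L] [TopologicalSpace X]
  [TopologicalSpace Y] [CompactSpace Y] [Nonempty Y]

namespace StrictAmb

/-- Strict `L`-ambiguous representations are ordered by inclusion. -/
instance instPartialOrder : PartialOrder (StrictAmb L X Y) :=
  PartialOrder.lift carrier fun _ _ h => StrictAmb.ext h

/-- The relation `R^∪`: the triples `(𝒜, B, γ)` in `exp² X × exp Y × L` such that `γ` is at most
`sup {α | (A, B, α) ∈ R for some A ∈ 𝒜}`. -/
def cup (R : StrictAmb L X Y) : Set (Hyp (Hyp X) × Hyp Y × L) :=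
  {t | ∃ s : L, IsLUB {α : L | ∃ A ∈ t.1, (A, t.2.1, α) ∈ R.carrier} s ∧ t.2.2 ≤ s}

/-- The topology induced on `Csamb_L(X,Y)` by `R ↦ R^∪` from the Vietoris topology.  (The topology
of the hyperspace `exp` is itself induced from the Vietoris topology on all subsets, so this is the
topology that makes `R ↦ R^∪` inducing as a map into `exp (exp² X × exp Y × L)`, once all `R^∪` are
elements of that hyperspace.) -/
instance instTopologicalSpace : TopologicalSpace (StrictAmb L X Y) :=
  TopologicalSpace.induced cup (TopologicalSpace.vietoris _)

end StrictAmb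

/-- `𝒜^⊂`: the closed non-empty `ℬ ⊆ exp X` such that each `A ∈ 𝒜` contains some `B ∈ ℬ`. -/
def refines (𝒜 : Hyp (Hyp X)) : Set (Hyp (Hyp X)) :=
  {ℬ | ∀ A ∈ 𝒜, ∃ B ∈ ℬ, (B : Set X) ⊆ A}

/-- `T^⊂`: the union of the sets `𝒜^⊂ × {B} × {α}↓` over all `(𝒜, B, α) ∈ T`. -/
def subOp (T : Set (Hyp (Hyp X) × Hyp Y × L)) : Set (Hyp (Hyp X) × Hyp Y × L) :=
  {t | ∃ 𝒜 : Hyp (Hyp X), ∃ α : L, (𝒜, t.2.1, α) ∈ T ∧ t.1 ∈ refines 𝒜 ∧ t.2.2 ≤ α}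

/-- `T^sup`: the triples `(⋃ pr₁ F, ⋃ pr₂ F, sup pr₃ F)` for all closed non-empty `F ⊆ T`. -/
def supOp (T : Set (Hyp (Hyp X) × Hyp Y × L)) : Set (Hyp (Hyp X) × Hyp Y × L) :=
  {t | ∃ F : Set (Hyp (Hyp X) × Hyp Y × L), IsClosed F ∧ F.Nonempty ∧ F ⊆ T ∧
    (t.1 : Set (Hyp X)) = ⋃ f ∈ F, (f.1 : Set (Hyp X)) ∧
    (t.2.1 : Set Y) = ⋃ f ∈ F, (f.2.1 : Set Y) ∧
    IsLUB ((fun f => f.2.2) '' F) t.2.2}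

/-- `T^+ = ((T ∪ exp² X × {Y} × L ∪ exp² X × exp Y × {0})^⊂)^sup`. -/
def plusOp (T : Set (Hyp (Hyp X) × Hyp Y × L)) : Set (Hyp (Hyp X) × Hyp Y × L) :=
  supOp (subOp (T ∪ {t | t.2.1 = ⊤} ∪ {t | t.2.2 = ⊥}))

end

end AmbRep

/-! Distributivity and the two small-semilattice conditions give Raney's property: `x ≰ y` yields `u
≰ y` and `v` with `x ≰ v` such that every `z` is above `u` or below `v`. Every topological argument
about suprema uses this: if `γ` is not below a supremum, no member lies above `u`; compactness
spreads this open condition uniformly to nearby points, and there all members, hence their suprema,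
stay below `v`, while `γ ≰ v`.

A representation is recovered from `R^∪` on singletons (`mem_carrier_iff_le_val`), so `R ↦ R^∪` is
an order embedding. For compactness, the values `R.val 𝒜 B` converge along an ultrafilter for each
fixed `(𝒜, B)`; testing the limits on thickenings defines a representation, and the ultrafilter
converges to it (`mem_cup_limit`, `le_nhds_limit`).

The order is controlled by `exists_separating`: if `R ≰ P`, some `M` is not above `R`, while `Iic M`
is a neighbourhood of every `Q ≤ P`. In a compact Hausdorff ordered space with closed sets `Iic m`,
this makes the order closed and, once closed non-empty sets have suprema, makes suprema continuous
and gives small subsemilattices. The suprema are pointwise (`compactSup`). -/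

namespace AmbRep

section Development

open Filter TopologicalSpace

universe u v w

/-! ### Compact Lawson lattices and Raney separation -/

section Lattice

theorem exists_isLeast_of_infClosed {L : Type*} [TopologicalSpace L] [SemilatticeInf L]
    [ClosedIicTopology L] [T2Space L] {s : Set L} (hs : IsCompact s) (hne : s.Nonempty)
    (hinf : InfClosed s) : ∃ m, IsLeast s m := by
  have : Nonempty s := hne.to_subtype
  obtain ⟨m, hm⟩ := IsCompact.nonempty_iInter_of_directed_nonempty_isCompact_isClosed
    (fun i : s => s ∩ Iic (i : L))
    (fun i j => ⟨⟨i ⊓ j, hinf i.2 j.2⟩,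
      fun x hx => ⟨hx.1, le_trans hx.2 (inf_le_left : (i : L) ⊓ j ≤ i)⟩,
      fun x hx => ⟨hx.1, le_trans hx.2 (inf_le_right : (i : L) ⊓ j ≤ j)⟩⟩)
    (fun i => ⟨i, i.2, le_refl (i : L)⟩) (fun i => hs.inter_right isClosed_Iic)
    (fun i => hs.isClosed.inter isClosed_Iic)
  rw [mem_iInter] at hm
  exact ⟨m, (hm (Classical.arbitrary s)).1, fun x hx => (hm ⟨x, hx⟩).2⟩

theorem exists_isGreatest_of_supClosed {L : Type*} [TopologicalSpace L] [SemilatticeSup L]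
    [ClosedIciTopology L] [T2Space L] {s : Set L} (hs : IsCompact s) (hne : s.Nonempty)
    (hsup : SupClosed s) : ∃ m, IsGreatest s m :=
  haveI : T2Space Lᵒᵈ := ‹T2Space L›
  exists_isLeast_of_infClosed (L := Lᵒᵈ) hs hne hsup

theorem exists_isLUB_of_compactSpace {L : Type*} [TopologicalSpace L] [Lattice L] [OrderTop L]
    [OrderClosedTopology L] [CompactSpace L] (s : Set L) : ∃ m, IsLUB s m := by
  refine exists_isLeast_of_infClosed (IsClosed.isCompact ?_) ⟨⊤, fun _ _ => le_top⟩
    (fun a ha b hb x hx => le_inf (ha hx) (hb hx))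
  have : upperBounds s = ⋂ x ∈ s, Ici x := by ext; simp [upperBounds]
  rw [this]
  exact isClosed_biInter fun _ _ => isClosed_Ici

/-- A closed neighbourhood of `x` that misses `Iic y` contains an inf-closed neighbourhood; the
closure of the latter is compact and inf-closed, and `u` is its least element. -/
theorem exists_Ici_mem_nhds {L : Type*} [TopologicalSpace L] [SemilatticeInf L]
    [OrderClosedTopology L] [CompactSpace L] [ContinuousInf L]
    (small : ∀ p : L, ∀ U ∈ 𝓝 p, ∃ V ∈ 𝓝 p, V ⊆ U ∧ InfClosed V) {x y : L} (h : ¬ x ≤ y) :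
    ∃ u, ¬ u ≤ y ∧ Ici u ∈ 𝓝 x := by
  obtain ⟨K, ⟨hK, hKc⟩, hKy⟩ := (closed_nhds_basis x).mem_iff.1
    ((isClosed_Iic (a := y)).isOpen_compl.mem_nhds h)
  obtain ⟨V, hV, hVK, hinf⟩ := small x K hK
  obtain ⟨u, hu, hul⟩ := exists_isLeast_of_infClosed (isClosed_closure (s := V)).isCompact
    ⟨x, subset_closure (mem_of_mem_nhds hV)⟩
    (fun a ha b hb => map_mem_closure₂ continuous_inf ha hb fun a ha b hb => hinf ha hb)
  exact ⟨u, hKy (hKc.closure_subset_iff.2 hVK hu),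
    mem_of_superset hV fun z hz => hul (subset_closure hz)⟩

theorem exists_Iic_mem_nhds {L : Type*} [TopologicalSpace L] [SemilatticeSup L]
    [OrderClosedTopology L] [CompactSpace L] [ContinuousSup L]
    (small : ∀ p : L, ∀ U ∈ 𝓝 p, ∃ V ∈ 𝓝 p, V ⊆ U ∧ SupClosed V) {x y : L} (h : ¬ x ≤ y) :
    ∃ v, ¬ x ≤ v ∧ Iic v ∈ 𝓝 y :=
  haveI : CompactSpace Lᵒᵈ := ‹CompactSpace L›
  exists_Ici_mem_nhds (L := Lᵒᵈ) small h

/-- Raney's separation property, which characterizes complete distributivity. -/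
def RaneySeparated (L : Type*) [LE L] : Prop :=
  ∀ x y : L, ¬ x ≤ y → ∃ u v, ¬ u ≤ y ∧ ¬ x ≤ v ∧ ∀ z, u ≤ z ∨ z ≤ v

/-- If `x ≰ y`, then there is a prime element above `y` that is not above `x`. -/
theorem exists_prime_above {L : Type*} [TopologicalSpace L] [DistribLattice L]
    [OrderClosedTopology L] [CompactSpace L] [ContinuousInf L]
    (small : ∀ p : L, ∀ U ∈ 𝓝 p, ∃ V ∈ 𝓝 p, V ⊆ U ∧ InfClosed V) {x y : L} (h : ¬ x ≤ y) :
    ∃ p, y ≤ p ∧ ¬ x ≤ p ∧ ∀ a b, a ⊓ b ≤ p → a ≤ p ∨ b ≤ p := by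
  have step : ∀ z : {z : L // ¬ z ≤ y}, ∃ u : {z : L // ¬ z ≤ y}, Ici (u : L) ∈ 𝓝 (z : L) :=
    fun z => (exists_Ici_mem_nhds small z.2).elim fun u hu => ⟨⟨u, hu.1⟩, hu.2⟩
  choose f hf using step
  -- Since `Ici (w (n + 1))` is a neighbourhood of `w n`, the filter generated by this descending
  -- sequence is open.
  let w : ℕ → {z : L // ¬ z ≤ y} := fun n => f^[n] ⟨x, h⟩
  have hw : ∀ n, Ici (w (n + 1) : L) ∈ 𝓝 (w n : L) := fun n => by
    have : w (n + 1) = f (w n) := Function.iterate_succ_apply' f n _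
    rw [this]; exact hf _
  have hanti : Antitone fun n => (w n : L) :=
    antitone_nat_of_succ_le fun n => mem_of_mem_nhds (hw n)
  set F : Set L := {z | ∃ n, (w n : L) ≤ z} with hF
  have hFopen : IsOpen F := by
    refine isOpen_iff_mem_nhds.2 fun z ⟨n, hn⟩ => ?_
    have : Tendsto (fun t => t ⊓ (w n : L)) (𝓝 z) (𝓝 (w n : L)) := by
      have h1 : Continuous fun t : L => t ⊓ (w n : L) := by fun_prop
      simpa [inf_eq_right.2 hn] using h1.tendsto z
    filter_upwards [this (hw n)] with t ht
    exact ⟨n + 1, le_trans ht inf_le_left⟩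
  have hyF : y ∈ Fᶜ := fun ⟨n, hn⟩ => (w n).2 hn
  -- The complement of `F` is compact, so every chain in it has an upper bound there; a maximal
  -- element outside an open filter is prime.
  obtain ⟨p, hyp, hp⟩ := zorn_le_nonempty₀ Fᶜ (fun c hc hchain z hz => by
    have hcl : closure c ⊆ Fᶜ := hFopen.isClosed_compl.closure_subset_iff.2 hc
    have : Nonempty c := ⟨⟨z, hz⟩⟩
    obtain ⟨m, hm⟩ := IsCompact.nonempty_iInter_of_directed_nonempty_isCompact_isClosed
      (fun i : c => closure c ∩ Ici (i : L))
      (fun i j => by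
        rcases hchain.total i.2 j.2 with hij | hij
        · exact ⟨j, fun t ht => ⟨ht.1, hij.trans ht.2⟩, fun t ht => ht⟩
        · exact ⟨i, fun t ht => ht, fun t ht => ⟨ht.1, hij.trans ht.2⟩⟩)
      (fun i => ⟨i, subset_closure i.2, le_refl (i : L)⟩)
      (fun i => (isClosed_closure.inter isClosed_Ici).isCompact)
      (fun i => isClosed_closure.inter isClosed_Ici)
    rw [mem_iInter] at hm
    exact ⟨m, hcl (hm ⟨z, hz⟩).1, fun i hi => (hm ⟨i, hi⟩).2⟩) y hyF
  refine ⟨p, hyp, fun hxp => hp.prop ⟨0, hxp⟩, fun a b hab => ?_⟩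
  by_contra! hcon
  have key : ∀ a, ¬ a ≤ p → ∃ n, (w n : L) ≤ a ⊔ p := fun a ha => by
    by_contra hn
    exact ha (le_sup_left.trans (hp.le_of_ge (y := a ⊔ p) hn le_sup_right))
  obtain ⟨n, hn⟩ := key a hcon.1
  obtain ⟨m, hm⟩ := key b hcon.2
  refine hp.prop ⟨max n m, ?_⟩
  calc (w (max n m) : L) ≤ (a ⊔ p) ⊓ (b ⊔ p) :=
        le_inf ((hanti (le_max_left _ _)).trans hn) ((hanti (le_max_right _ _)).trans hm)
    _ = a ⊓ b ⊔ p := sup_inf_right _ _ _ |>.symm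
    _ ≤ p := sup_le hab le_rfl

theorem orderClosedTopology_of_continuousInf {L : Type*} [TopologicalSpace L] [SemilatticeInf L]
    [T2Space L] [ContinuousInf L] : OrderClosedTopology L where
  isClosed_le' := by
    simp_rw [← inf_eq_left]
    exact isClosed_eq (by fun_prop) continuous_fst

/-- Take a prime `p ≥ y` with `x ≰ p`, and `v` with `x ≰ v` and `Iic v` a neighbourhood of `p`. Each
point of the compact closure of the complement of `Iic v` has a neighbourhood `Ici u` with `u ≰ p`;
finitely many suffice, and primeness keeps the meet of their `u` from lying below `p`. -/
theorem raneySeparated_of_small {L : Type*} [TopologicalSpace L] [DistribLattice L]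
    [OrderTop L] [OrderClosedTopology L] [CompactSpace L] [TopologicalLattice L]
    (small_sup : ∀ p : L, ∀ U ∈ 𝓝 p, ∃ V ∈ 𝓝 p, V ⊆ U ∧ SupClosed V)
    (small_inf : ∀ p : L, ∀ U ∈ 𝓝 p, ∃ V ∈ 𝓝 p, V ⊆ U ∧ InfClosed V) : RaneySeparated L := by
  intro x y hxy
  obtain ⟨p, hyp, hxp, hprime⟩ := exists_prime_above small_inf hxy
  obtain ⟨v, hxv, hv⟩ := exists_Iic_mem_nhds small_sup hxp
  have hC : closure (Iic v)ᶜ ⊆ {z | ¬ z ≤ p} := by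
    intro z hz hzp
    rw [closure_compl, mem_compl_iff, mem_interior_iff_mem_nhds] at hz
    have : Tendsto (fun t => t ⊔ p) (𝓝 z) (𝓝 p) := by
      have h1 : Continuous fun t : L => t ⊔ p := by fun_prop
      simpa [sup_eq_right.2 hzp] using h1.tendsto z
    exact hz (mem_of_superset (this hv) fun t ht => le_sup_left.trans ht)
  have hu : ∃ u, ¬ u ≤ p ∧ ∀ z ∈ closure (Iic v)ᶜ, u ≤ z := by
    refine IsCompact.induction_on (isClosed_closure (s := (Iic v)ᶜ)).isCompact
      (p := fun s => ∃ u, ¬ u ≤ p ∧ ∀ z ∈ s, u ≤ z) ?_ ?_ ?_ ?_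
    · exact ⟨⊤, fun h => hxp (le_top.trans h), by simp⟩
    · exact fun s t hst ⟨u, hu, h⟩ => ⟨u, hu, fun z hz => h z (hst hz)⟩
    · rintro s t ⟨a, ha, has⟩ ⟨b, hb, hbt⟩
      refine ⟨a ⊓ b, fun h => (hprime a b h).elim ha hb, ?_⟩
      rintro z (hz | hz)
      · exact inf_le_left.trans (has z hz)
      · exact inf_le_right.trans (hbt z hz)
    · intro z hz
      obtain ⟨u, hup, hu⟩ := exists_Ici_mem_nhds small_inf (hC hz)
      exact ⟨Ici u, mem_nhdsWithin_of_mem_nhds hu, u, hup, fun _ h => h⟩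
  obtain ⟨u, hup, hu⟩ := hu
  refine ⟨u, v, fun h => hup (h.trans hyp), hxv, fun z => ?_⟩
  by_cases hz : z ≤ v
  · exact Or.inr hz
  · exact Or.inl (hu z (subset_closure hz))

end Lattice

/-! ### Vietoris neighbourhoods and thickenings -/

section Hyperspace


/-- Each neighbourhood of a point of the hyperspace contains arbitrarily small thickenings of the
point. -/
theorem exists_thickening_mem {Z : Type*} [TopologicalSpace Z] [CompactSpace Z] [T2Space Z]
    {K : Hyp Z} {U : Set (Hyp Z)} (hU : U ∈ 𝓝 K) :
    ∃ N : Hyp Z, (K : Set Z) ⊆ interior N ∧ N ∈ U := by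
  obtain ⟨_, ⟨u, ⟨-, -, hu⟩, rfl⟩, hK, hU⟩ :=
    (NonemptyCompacts.isTopologicalBasis (α := Z)).mem_nhds_iff.1 hU
  obtain ⟨N, hN, hKN, hNu⟩ := exists_compact_between K.isCompact (isOpen_sUnion hu) hK.1
  exact ⟨⟨⟨N, hN⟩, K.nonempty.mono (hKN.trans interior_subset)⟩, hKN,
    hU ⟨hNu, fun V hV => (hK.2 V hV).mono (inter_subset_inter_left _
      (hKN.trans interior_subset))⟩⟩

theorem eventually_subset_of_subset_interior {Z : Type*} [TopologicalSpace Z] {K N : Hyp Z}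
    (h : (K : Set Z) ⊆ interior N) : ∀ᶠ K' : Hyp Z in 𝓝 K, (K' : Set Z) ⊆ N :=
  mem_of_superset ((NonemptyCompacts.isOpen_subsets_of_isOpen isOpen_interior).mem_nhds h)
    fun _ hK' => hK'.trans interior_subset

/-- The elements that contain a member of an open family form an open family. -/
theorem isOpen_exists_subset {Z : Type*} [TopologicalSpace Z] {O : Set (Hyp Z)} (hO : IsOpen O) :
    IsOpen {C : Hyp Z | ∃ D ∈ O, (D : Set Z) ⊆ C} := by
  refine isOpen_iff_mem_nhds.2 fun C ⟨D, hD, hDC⟩ => ?_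
  obtain ⟨_, ⟨u, ⟨hfin, hne, hu⟩, rfl⟩, hD', hU⟩ :=
    (NonemptyCompacts.isTopologicalBasis (α := Z)).mem_nhds_iff.1 (hO.mem_nhds hD)
  have hopen : IsOpen {C : Hyp Z | ∀ V ∈ u, ((C : Set Z) ∩ V).Nonempty} := by
    simp_rw [ofPred_forall]
    exact hfin.isOpen_biInter fun V hV =>
      NonemptyCompacts.isOpen_inter_nonempty_of_isOpen (hu V hV)
  filter_upwards [hopen.mem_nhds fun V hV => (hD'.2 V hV).mono (inter_subset_inter_left _ hDC)]
    with C' hC'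
  have : Nonempty Z := ⟨D.nonempty.some⟩
  choose! x hxC hxV using fun V (hV : V ∈ u) => hC' V hV
  -- One point of `C'` from each member of the finite family `u` gives a finite subset of `C'` in
  -- the basic neighbourhood of `D`.
  refine ⟨⟨⟨x '' u, (hfin.image x).isCompact⟩, by exact hne.image x⟩, hU ⟨?_, fun V hV => ?_⟩, ?_⟩
  · rintro _ ⟨V, hV, rfl⟩
    exact ⟨V, hV, hxV V hV⟩
  · exact ⟨x V, mem_image_of_mem x hV, hxV V hV⟩
  · rintro _ ⟨V, hV, rfl⟩
    exact hxC V hV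

end Hyperspace

namespace StrictAmb

/-! ### Values of a representation and closedness -/

section Carrier

variable {L : Type w} {X : Type u} {Y : Type v}
  [TopologicalSpace L] [DistribLattice L] [BoundedOrder L]
  [TopologicalSpace X] [TopologicalSpace Y] [CompactSpace Y] [T2Space Y] [Nonempty Y]

/-- Monotonicity in `B` upgrades separate to joint closedness: a triple outside stays outside when
`B` is thickened to `N`, then when `(A, α)` moves with `N` fixed, and so for all `B' ⊆ N`. -/
theorem isClosed_carrier (R : StrictAmb L X Y) : IsClosed R.carrier := by
  rw [← isOpen_compl_iff, isOpen_iff_mem_nhds]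
  rintro ⟨A, B, α⟩ h
  have hB : {B' | (A, B', α) ∉ R.carrier} ∈ 𝓝 B :=
    ((R.closed_right A).isOpen_compl.preimage
      (f := fun B' : Hyp Y => (B', α)) (by fun_prop)).mem_nhds h
  obtain ⟨N, hBN, hN⟩ := exists_thickening_mem hB
  have hA : {p : Hyp X × L | (p.1, N, p.2) ∉ R.carrier} ∈ 𝓝 (A, α) :=
    (R.closed_left N).isOpen_compl.mem_nhds hN
  have hcont : Tendsto (fun t : Hyp X × Hyp Y × L => (t.1, t.2.2)) (𝓝 (A, B, α)) (𝓝 (A, α)) :=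
    Continuous.tendsto (by fun_prop) _
  have hsnd : Tendsto (fun t : Hyp X × Hyp Y × L => t.2.1) (𝓝 (A, B, α)) (𝓝 B) :=
    Continuous.tendsto (f := fun t : Hyp X × Hyp Y × L => t.2.1) (by fun_prop) _
  filter_upwards [hcont hA, hsnd (eventually_subset_of_subset_interior hBN)] with t ht htB hmem
  exact ht (R.mono _ _ _ _ _ _ Subset.rfl htB le_rfl hmem)

end Carrier

section Value

variable {L : Type w} {X : Type u} {Y : Type v}
  [TopologicalSpace L] [DistribLattice L] [BoundedOrder L] [CompactSpace L] [OrderClosedTopology L]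
  [TopologicalSpace X] [TopologicalSpace Y] [CompactSpace Y] [Nonempty Y]

/-- The supremum of all `α` such that `(A, B, α) ∈ R` for some `A ∈ 𝒜`. -/
noncomputable def val (R : StrictAmb L X Y) (𝒜 : Hyp (Hyp X)) (B : Hyp Y) : L :=
  Classical.choose
    (exists_isLUB_of_compactSpace {α : L | ∃ A ∈ 𝒜, (A, B, α) ∈ R.carrier})

variable {R S : StrictAmb L X Y} {𝒜 𝒜' : Hyp (Hyp X)} {B B' : Hyp Y} {A : Hyp X} {α γ b : L}

theorem isLUB_val (R : StrictAmb L X Y) (𝒜 : Hyp (Hyp X)) (B : Hyp Y) :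
    IsLUB {α : L | ∃ A ∈ 𝒜, (A, B, α) ∈ R.carrier} (R.val 𝒜 B) :=
  Classical.choose_spec
    (exists_isLUB_of_compactSpace {α : L | ∃ A ∈ 𝒜, (A, B, α) ∈ R.carrier})

theorem mem_cup : (𝒜, B, γ) ∈ R.cup ↔ γ ≤ R.val 𝒜 B := by
  constructor
  · rintro ⟨s, hs, hγ⟩
    exact hγ.trans_eq (hs.unique (R.isLUB_val 𝒜 B))
  · exact fun h => ⟨_, R.isLUB_val 𝒜 B, h⟩

theorem le_val (hA : A ∈ 𝒜) (h : (A, B, α) ∈ R.carrier) : α ≤ R.val 𝒜 B :=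
  (R.isLUB_val 𝒜 B).1 ⟨A, hA, h⟩

theorem val_le_iff : R.val 𝒜 B ≤ b ↔ ∀ A ∈ 𝒜, ∀ α, (A, B, α) ∈ R.carrier → α ≤ b := by
  rw [isLUB_le_iff (R.isLUB_val 𝒜 B)]
  exact ⟨fun h A hA α hα => h ⟨A, hA, hα⟩, fun h α ⟨A, hA, hα⟩ => h A hA α hα⟩

theorem val_le_val (h𝒜 : ∀ A ∈ 𝒜, ∃ A' ∈ 𝒜', (A' : Set X) ⊆ A) (hB : (B : Set Y) ⊆ B') :
    R.val 𝒜 B ≤ R.val 𝒜' B' :=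
  val_le_iff.2 fun A hA _ hα => by
    obtain ⟨A', hA', h⟩ := h𝒜 A hA
    exact le_val hA' (R.mono _ _ _ _ _ _ h hB le_rfl hα)

theorem val_mono (h𝒜 : (𝒜 : Set (Hyp X)) ⊆ 𝒜') (hB : (B : Set Y) ⊆ B') :
    R.val 𝒜 B ≤ R.val 𝒜' B' :=
  val_le_val (fun A hA => ⟨A, h𝒜 hA, Subset.rfl⟩) hB

theorem val_top : R.val 𝒜 ⊤ = ⊤ := by
  obtain ⟨A, hA⟩ := 𝒜.nonempty
  exact top_le_iff.1 (le_val hA (R.top_mem A ⊤))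

/-- The section of `R` over `(A, B)` is compact and sup-closed, so its supremum is attained. -/
theorem mem_carrier_iff_le_val : (A, B, α) ∈ R.carrier ↔ α ≤ R.val {A} B := by
  refine ⟨fun h => le_val (by simp) h, fun h => ?_⟩
  have hcl : IsClosed {α : L | (A, B, α) ∈ R.carrier} :=
    (R.closed_right A).preimage (f := fun α : L => (B, α)) (by fun_prop)
  obtain ⟨m, hm⟩ := exists_isGreatest_of_supClosed hcl.isCompact ⟨⊥, R.bot_mem A B⟩
    fun α hα β hβ => R.sup_mem A B α β hα hβ
  refine R.mono A A B B m α Subset.rfl Subset.rfl (h.trans (val_le_iff.2 ?_)) hm.1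
  rintro A' hA' β hβ
  rw [NonemptyCompacts.mem_singleton] at hA'
  exact hm.2 (hA' ▸ hβ)

theorem le_iff_cup_subset : R ≤ S ↔ R.cup ⊆ S.cup := by
  constructor
  · rintro h ⟨𝒜, B, γ⟩ hγ
    exact mem_cup.2 ((mem_cup.1 hγ).trans (val_le_iff.2 fun A hA α hα => le_val hA (h hα)))
  · rintro h ⟨A, B, α⟩ hα
    exact mem_carrier_iff_le_val.2 (mem_cup.1 (h (mem_cup.2 (mem_carrier_iff_le_val.1 hα))))

theorem val_le_val_of_le (h : R ≤ S) : R.val 𝒜 B ≤ S.val 𝒜 B :=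
  mem_cup.1 (le_iff_cup_subset.1 h (mem_cup.2 le_rfl))

theorem cup_injective : Function.Injective (cup : StrictAmb L X Y → _) := fun _ _ h =>
  le_antisymm (le_iff_cup_subset.2 h.subset) (le_iff_cup_subset.2 h.superset)

theorem cup_nonempty [Nonempty X] (R : StrictAmb L X Y) : R.cup.Nonempty :=
  ⟨({{Classical.arbitrary X}}, ⊤, ⊤), mem_cup.2 val_top.ge⟩

variable [T2Space Y]

/-- If `γ` is not below the value, Raney's `u` fails on all of `𝒜 × {B}`; by the tube lemma it fails
nearby, where values are then at most `v`. -/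
theorem isClosed_cup (hL : RaneySeparated L) (R : StrictAmb L X Y) : IsClosed R.cup := by
  rw [← isOpen_compl_iff, isOpen_iff_mem_nhds]
  rintro ⟨𝒜, B, γ⟩ h
  obtain ⟨u, v, hu, hv, huv⟩ := hL _ _ (mem_cup.not.1 h)
  have hcl : IsClosed {p : Hyp X × Hyp Y | (p.1, p.2, u) ∈ R.carrier} :=
    R.isClosed_carrier.preimage (f := fun p : Hyp X × Hyp Y => (p.1, p.2, u)) (by fun_prop)
  obtain ⟨O, V, hO, hV, h𝒜O, hBV, hOV⟩ := generalized_tube_lemma 𝒜.isCompact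
    (isCompact_singleton (x := B)) hcl.isOpen_compl (by
      rintro ⟨A, B'⟩ ⟨hA, rfl⟩ hmem
      exact hu (le_val hA hmem))
  refine mem_of_superset (prod_mem_nhds
    ((NonemptyCompacts.isOpen_subsets_of_isOpen hO).mem_nhds h𝒜O)
    (prod_mem_nhds (hV.mem_nhds (hBV rfl)) ((isClosed_Iic (a := v)).isOpen_compl.mem_nhds hv))) ?_
  rintro ⟨𝒜', B', γ'⟩ ⟨h𝒜', hB', hγ'⟩ hmem
  refine hγ' ((mem_cup.1 hmem).trans (val_le_iff.2 fun A hA α hα => ?_))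
  exact (huv α).resolve_left fun huα =>
    hOV (mk_mem_prod (h𝒜' hA) hB') (R.mono _ _ _ _ _ _ Subset.rfl Subset.rfl huα hα)

end Value

section Topology

variable {L : Type w} {X : Type u} {Y : Type v}
  [TopologicalSpace L] [DistribLattice L] [BoundedOrder L]
  [TopologicalSpace X] [TopologicalSpace Y] [CompactSpace Y] [Nonempty Y]

theorem isOpen_cup_subset {O : Set (Hyp (Hyp X) × Hyp Y × L)} (hO : IsOpen O) :
    IsOpen {R : StrictAmb L X Y | R.cup ⊆ O} :=
  ⟨_, hO.powerset_vietoris, rfl⟩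

theorem le_nhds_of_cup {l : Filter (StrictAmb L X Y)} {S : StrictAmb L X Y}
    (hsub : ∀ O, IsOpen O → S.cup ⊆ O → ∀ᶠ R in l, R.cup ⊆ O)
    (hmeet : ∀ O, IsOpen O → (S.cup ∩ O).Nonempty → ∀ᶠ R in l, (R.cup ∩ O).Nonempty) :
    l ≤ 𝓝 S := by
  let _ := TopologicalSpace.vietoris (Hyp (Hyp X) × Hyp Y × L)
  rw [nhds_induced, ← tendsto_iff_comap]
  refine tendsto_nhds_generateFrom_iff.2 ?_
  rintro _ (⟨O, hO, rfl⟩ | ⟨O, hO, rfl⟩) hS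
  · exact hsub O hO hS
  · exact hmeet O hO hS

end Topology

/-! ### Compactness through ultrafilter limits -/

section Limit

variable {L : Type w} {X : Type u} {Y : Type v}
  [TopologicalSpace L] [DistribLattice L] [BoundedOrder L] [CompactSpace L] [OrderClosedTopology L]
  [TopologicalSpace X] [TopologicalSpace Y] [CompactSpace Y] [Nonempty Y]

/-- The limit of the values at a fixed pair along an ultrafilter. -/
noncomputable def limVal (𝒰 : Ultrafilter (StrictAmb L X Y)) (𝒜 : Hyp (Hyp X)) (B : Hyp Y) : L :=
  (𝒰.map fun R => R.val 𝒜 B).lim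

theorem tendsto_limVal (𝒰 : Ultrafilter (StrictAmb L X Y)) (𝒜 : Hyp (Hyp X)) (B : Hyp Y) :
    Tendsto (fun R : StrictAmb L X Y => R.val 𝒜 B) 𝒰 (𝓝 (limVal 𝒰 𝒜 B)) :=
  (𝒰.map fun R : StrictAmb L X Y => R.val 𝒜 B).le_nhds_lim

theorem limVal_le_limVal (𝒰 : Ultrafilter (StrictAmb L X Y)) {𝒜 𝒜' : Hyp (Hyp X)} {B : Hyp Y}
    (h : ∀ A ∈ 𝒜, ∃ A' ∈ 𝒜', (A' : Set X) ⊆ A) : limVal 𝒰 𝒜 B ≤ limVal 𝒰 𝒜' B :=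
  le_of_tendsto_of_tendsto' (tendsto_limVal 𝒰 𝒜 B) (tendsto_limVal 𝒰 𝒜' B)
    fun _ => val_le_val h Subset.rfl

theorem limVal_top (𝒰 : Ultrafilter (StrictAmb L X Y)) (𝒜 : Hyp (Hyp X)) :
    limVal 𝒰 𝒜 ⊤ = ⊤ :=
  tendsto_nhds_unique (tendsto_limVal 𝒰 𝒜 ⊤) (by simp only [val_top]; exact tendsto_const_nhds)

/-- The set of triples whose value is dominated by the limit values at all thickenings. -/
def limCarrier (𝒰 : Ultrafilter (StrictAmb L X Y)) : Set (Hyp X × Hyp Y × L) :=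
  {t | ∀ (N : Hyp (Hyp X)) (B : Hyp Y), t.1 ∈ interior (N : Set (Hyp X)) →
    (t.2.1 : Set Y) ⊆ interior B → t.2.2 ≤ limVal 𝒰 N B}

theorem isClosed_limCarrier (𝒰 : Ultrafilter (StrictAmb L X Y)) : IsClosed (limCarrier 𝒰) := by
  simp only [limCarrier, ofPred_forall]
  refine isClosed_iInter fun N => isClosed_iInter fun B => ?_
  refine isClosed_imp (isOpen_interior.preimage continuous_fst) (isClosed_imp ?_ ?_)
  · exact (NonemptyCompacts.isOpen_subsets_of_isOpen isOpen_interior).preimage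
      (continuous_fst.comp continuous_snd)
  · exact isClosed_Iic.preimage (continuous_snd.comp continuous_snd)

variable [CompactSpace X]

/-- The set `R^∪` as a point of the hyperspace. -/
def cupHyp [T2Space Y] [Nonempty X] (hL : RaneySeparated L) (R : StrictAmb L X Y) :
    Hyp (Hyp (Hyp X) × Hyp Y × L) :=
  ⟨⟨R.cup, (R.isClosed_cup hL).isCompact⟩, R.cup_nonempty⟩

theorem isEmbedding_cupHyp [T2Space Y] [Nonempty X] (hL : RaneySeparated L) :
    IsEmbedding (cupHyp hL : StrictAmb L X Y → _) where
  eq_induced := (induced_compose (f := cupHyp hL)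
    (g := ((↑) : Hyp (Hyp (Hyp X) × Hyp Y × L) → Set (Hyp (Hyp X) × Hyp Y × L)))
    (tγ := TopologicalSpace.vietoris _)).symm
  injective _ _ h := cup_injective (congrArg SetLike.coe h)

theorem t2Space [T2Space X] [T2Space Y] [Nonempty X] (hL : RaneySeparated L) : T2Space (StrictAmb L X Y) :=
  (isEmbedding_cupHyp hL).t2Space

variable [T2Space X]

/-- The limit of an ultrafilter of strict ambiguous representations. -/
def limit (𝒰 : Ultrafilter (StrictAmb L X Y)) : StrictAmb L X Y where
  carrier := limCarrier 𝒰
  mono A A' B B' α α' hA hB hα h := by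
    intro N C hN hC
    -- Every hyperset near `A` contains a member of `N`, so a compact neighbourhood `M` of `A` has
    -- limit values bounded by those of `N`.
    have hO := (isOpen_exists_subset (isOpen_interior (s := (N : Set (Hyp X))))).mem_nhds
      (show A ∈ _ from ⟨A', hN, hA⟩)
    obtain ⟨K, hK, hKO, hKc⟩ := local_compact_nhds hO
    let M : Hyp (Hyp X) := ⟨⟨K, hKc⟩, ⟨A, mem_of_mem_nhds hK⟩⟩
    refine (hα.trans (h M C (mem_interior_iff_mem_nhds.2 hK) (hB.trans hC))).trans
      (limVal_le_limVal 𝒰 fun D hD => ?_)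
    obtain ⟨E, hE, hED⟩ := hKO hD
    exact ⟨E, interior_subset hE, hED⟩
  sup_mem A B α β hα hβ := fun N C hN hC => sup_le (hα N C hN hC) (hβ N C hN hC)
  top_mem A α := fun N C _ hC => by
    have : C = ⊤ := SetLike.coe_injective
      (univ_subset_iff.1 ((show univ ⊆ _ from hC).trans interior_subset))
    rw [this, limVal_top]
    exact le_top
  bot_mem A B := fun N C _ _ => bot_le
  closed_right A := (isClosed_limCarrier 𝒰).preimage
    (f := fun p : Hyp Y × L => (A, p.1, p.2)) (by fun_prop)
  closed_left B := (isClosed_limCarrier 𝒰).preimage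
    (f := fun p : Hyp X × L => (p.1, B, p.2)) (by fun_prop)

variable [T2Space Y]

theorem mem_cup_limit (hL : RaneySeparated L) {𝒰 : Ultrafilter (StrictAmb L X Y)}
    {𝒜 : Hyp (Hyp X)} {B : Hyp Y} {γ : L} :
    (𝒜, B, γ) ∈ (limit 𝒰).cup ↔ ∀ (N : Hyp (Hyp X)) (C : Hyp Y),
      (𝒜 : Set (Hyp X)) ⊆ interior N → (B : Set Y) ⊆ interior C → γ ≤ limVal 𝒰 N C := by
  rw [mem_cup]
  constructor
  · exact fun h N C hN hC => h.trans (val_le_iff.2 fun A hA α hα => hα N C (hN hA) hC)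
  intro h
  by_contra hγ
  obtain ⟨u, v, hu, hv, huv⟩ := hL _ _ hγ
  -- Around each `A ∈ 𝒜` the limit fails to reach `u` on some thickening, so almost all `R` have
  -- values at most `v` there; compactness of `𝒜` makes this uniform.
  have key : ∃ O : Set (Hyp X), IsOpen O ∧ (𝒜 : Set (Hyp X)) ⊆ O ∧ ∃ V : Set Y, IsOpen V ∧
      (B : Set Y) ⊆ V ∧ ∀ᶠ R : StrictAmb L X Y in 𝒰, ∀ A ∈ O, ∀ C : Hyp Y, (C : Set Y) ⊆ V → ∀ α,
        (A, C, α) ∈ R.carrier → α ≤ v := by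
    refine 𝒜.isCompact.induction_on (p := fun s => ∃ O : Set (Hyp X), IsOpen O ∧ s ⊆ O ∧
      ∃ V : Set Y, IsOpen V ∧ (B : Set Y) ⊆ V ∧ ∀ᶠ R : StrictAmb L X Y in 𝒰, ∀ A ∈ O, ∀ C : Hyp Y,
        (C : Set Y) ⊆ V → ∀ α, (A, C, α) ∈ R.carrier → α ≤ v) ?_ ?_ ?_ ?_
    · exact ⟨∅, isOpen_empty, Subset.rfl, univ, isOpen_univ, subset_univ _, by simp⟩
    · rintro s t hst ⟨O, hO, htO, hV⟩
      exact ⟨O, hO, hst.trans htO, hV⟩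
    · rintro s t ⟨O, hO, hsO, V, hV, hBV, hR⟩ ⟨O', hO', htO', V', hV', hBV', hR'⟩
      refine ⟨O ∪ O', hO.union hO', union_subset_union hsO htO', V ∩ V', hV.inter hV',
        subset_inter hBV hBV', ?_⟩
      filter_upwards [hR, hR'] with R hR hR'
      rintro A (hA | hA) C hC α hα
      · exact hR A hA C (hC.trans inter_subset_left) α hα
      · exact hR' A hA C (hC.trans inter_subset_right) α hα
    · intro A hA
      have hA' : (A, B, u) ∉ (limit 𝒰).carrier := fun hmem => hu (le_val hA hmem)
      change ¬ ∀ N C, _ at hA'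
      push Not at hA'
      obtain ⟨N, C, hN, hC, hlim⟩ := hA'
      refine ⟨interior N, mem_nhdsWithin_of_mem_nhds (isOpen_interior.mem_nhds hN),
        interior N, isOpen_interior, Subset.rfl, interior C, isOpen_interior, hC, ?_⟩
      filter_upwards [tendsto_limVal 𝒰 N C ((isClosed_Ici (a := u)).isOpen_compl.mem_nhds hlim)]
        with R hR A' hA' C' hC' α hα
      exact (le_val (interior_subset hA') (R.mono _ _ _ _ _ _ Subset.rfl
        (hC'.trans interior_subset) le_rfl hα)).trans ((huv _).resolve_left hR)
  obtain ⟨O, hO, h𝒜O, V, hV, hBV, hR⟩ := key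
  obtain ⟨N, h𝒜N, hNO⟩ := exists_thickening_mem
    ((NonemptyCompacts.isOpen_subsets_of_isOpen hO).mem_nhds h𝒜O)
  obtain ⟨C, hBC, hCV⟩ := exists_thickening_mem
    ((NonemptyCompacts.isOpen_subsets_of_isOpen hV).mem_nhds hBV)
  refine hv ((h N C h𝒜N hBC).trans (le_of_tendsto (tendsto_limVal 𝒰 N C) ?_))
  filter_upwards [hR] with R hR
  exact val_le_iff.2 fun A hA α hα => hR A (hNO hA) C hCV α hα

theorem le_nhds_limit [ContinuousInf L] (hL : RaneySeparated L)
    (𝒰 : Ultrafilter (StrictAmb L X Y)) : (𝒰 : Filter (StrictAmb L X Y)) ≤ 𝓝 (limit 𝒰) := by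
  refine le_nhds_of_cup (fun O hO hsub => ?_) (fun O hO hmeet => ?_)
  -- Each point outside `O` has a neighbourhood avoided by almost all `R.cup`; the complement of `O`
  -- is compact, so almost all `R.cup` avoid it entirely.
  · have hall : ∀ t ∈ Oᶜ, {p : StrictAmb L X Y × (Hyp (Hyp X) × Hyp Y × L) | p.2 ∉ p.1.cup} ∈
        (𝒰 : Filter (StrictAmb L X Y)) ×ˢ 𝓝 t := by
      rintro ⟨𝒜, B, γ⟩ ht
      have ht' := (mem_cup_limit hL).not.1 (fun hmem => ht (hsub hmem))
      push Not at ht'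
      obtain ⟨N, C, hN, hC, hlim⟩ := ht'
      have hopen : {p : L × L | ¬ p.2 ≤ p.1} ∈ 𝓝 (limVal 𝒰 N C, γ) :=
        (isClosed_le continuous_snd continuous_fst).isOpen_compl.mem_nhds hlim
      rw [nhds_prod_eq] at hopen
      have h1 : Tendsto (fun p : StrictAmb L X Y × (Hyp (Hyp X) × Hyp Y × L) => p.2)
        ((𝒰 : Filter (StrictAmb L X Y)) ×ˢ 𝓝 (𝒜, B, γ)) (𝓝 (𝒜, B, γ)) := tendsto_snd
      have h𝒜 := (continuous_fst.tendsto _).comp h1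
      have hB := ((continuous_fst.comp continuous_snd).tendsto _).comp h1
      have hγ := ((continuous_snd.comp continuous_snd).tendsto _).comp h1
      filter_upwards [((tendsto_limVal 𝒰 N C).comp tendsto_fst).prodMk hγ hopen,
        h𝒜 (eventually_subset_of_subset_interior hN),
        hB (eventually_subset_of_subset_interior hC)] with p hp hp𝒜 hpB hmem
      exact hp ((mem_cup.1 hmem).trans (val_mono hp𝒜 hpB))
    obtain ⟨s, hs, W, hW, hsW⟩ := Filter.mem_prod_iff.1
      (hO.isClosed_compl.isCompact.mem_prod_nhdsSet_of_forall hall)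
    filter_upwards [hs] with R hR t ht
    by_contra hOt
    exact hsW (mk_mem_prod hR (subset_of_mem_nhdsSet hW hOt)) ht
  · obtain ⟨⟨𝒜, B, γ⟩, hmem, ht⟩ := hmeet
    obtain ⟨U, hU, W, hW, hUW⟩ := mem_nhds_prod_iff.1 (hO.mem_nhds ht)
    obtain ⟨V, hV, G, hG, hVG⟩ := mem_nhds_prod_iff.1 hW
    obtain ⟨N, hN, hNU⟩ := exists_thickening_mem hU
    obtain ⟨C, hC, hCV⟩ := exists_thickening_mem hV
    have hle := (mem_cup_limit hL).1 hmem N C hN hC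
    -- Truncating the value at `γ` gives a third coordinate that converges to `γ` and stays inside
    -- `R.cup`.
    have hlim : Tendsto (fun R : StrictAmb L X Y => R.val N C ⊓ γ) 𝒰 (𝓝 γ) := by
      have := (tendsto_limVal 𝒰 N C).inf_nhds (tendsto_const_nhds (x := γ))
      rwa [inf_eq_right.2 hle] at this
    filter_upwards [hlim hG] with R hR
    exact ⟨(N, C, R.val N C ⊓ γ), mem_cup.2 inf_le_left,
      hUW (mk_mem_prod hNU (hVG (mk_mem_prod hCV hR)))⟩

theorem compactSpace [ContinuousInf L] (hL : RaneySeparated L) :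
    CompactSpace (StrictAmb L X Y) :=
  ⟨isCompact_iff_ultrafilter_le_nhds.2 fun 𝒰 _ => ⟨limit 𝒰, mem_univ _, le_nhds_limit hL 𝒰⟩⟩

end Limit

end StrictAmb

/-! ### Compact ordered spaces with separating elements -/

section OrderedSpace

theorem coe_singleton_sup_singleton {Z : Type*} [TopologicalSpace Z] (x y : Z) :
    (({x} ⊔ {y} : Hyp Z) : Set Z) = {x, y} := by
  rw [NonemptyCompacts.coe_sup, NonemptyCompacts.coe_singleton, NonemptyCompacts.coe_singleton,
    singleton_union]

variable {Z : Type*} [TopologicalSpace Z] [PartialOrder Z] [ClosedIicTopology Z]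

theorem orderClosedTopology_of_separated
    (hsep : ∀ x y : Z, ¬ x ≤ y → ∃ m, ¬ x ≤ m ∧ ∀ z ≤ y, Iic m ∈ 𝓝 z) :
    OrderClosedTopology Z where
  isClosed_le' := by
    rw [← isOpen_compl_iff, isOpen_iff_mem_nhds]
    rintro ⟨x, y⟩ hxy
    obtain ⟨m, hxm, hm⟩ := hsep x y hxy
    refine mem_of_superset (prod_mem_nhds ((isClosed_Iic (a := m)).isOpen_compl.mem_nhds hxm)
      (hm y le_rfl)) ?_
    rintro ⟨x', y'⟩ ⟨hx', hy'⟩ hle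
    exact hx' (le_trans hle hy')

variable [CompactSpace Z]

theorem continuous_of_isLUB
    (hsep : ∀ x y : Z, ¬ x ≤ y → ∃ m, ¬ x ≤ m ∧ ∀ z ≤ y, Iic m ∈ 𝓝 z)
    {σ : Hyp Z → Z} (hσ : ∀ K : Hyp Z, IsLUB (K : Set Z) (σ K)) : Continuous σ := by
  -- By compactness `σ` has a limit along every ultrafilter, and the separating elements force it to
  -- be `σ K`.
  refine continuous_iff_ultrafilter.2 fun K g hg => ?_
  have hlim : Tendsto σ g (𝓝 (g.map σ).lim) := (g.map σ).le_nhds_lim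
  suffices h : (g.map σ).lim = σ K by rwa [h] at hlim
  refine le_antisymm ?_ ((isLUB_le_iff (hσ K)).2 fun x hx => ?_)
  · by_contra hle
    obtain ⟨m, hm, hnhds⟩ := hsep _ _ hle
    refine hm (isClosed_Iic.mem_of_tendsto hlim ?_)
    have hK : (K : Set Z) ⊆ interior (Iic m) := fun x hx =>
      mem_interior_iff_mem_nhds.2 (hnhds x ((hσ K).1 hx))
    filter_upwards [hg ((NonemptyCompacts.isOpen_subsets_of_isOpen isOpen_interior).mem_nhds hK)]
      with K' hK'
    exact (isLUB_le_iff (hσ K')).2 fun x hx => interior_subset (s := Iic m) (hK' hx)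
  · by_contra hle
    obtain ⟨m, hm, hnhds⟩ := hsep _ _ hle
    have h1 := hlim (hnhds _ le_rfl)
    have h2 := hg ((NonemptyCompacts.isOpen_inter_nonempty_of_isOpen
      (isClosed_Iic (a := m)).isOpen_compl).mem_nhds ⟨x, hx, hm⟩)
    obtain ⟨K', hK', y, hy, hym⟩ := g.neBot.nonempty_of_mem (inter_mem h1 h2)
    exact hym (((hσ K').1 hy).trans hK')

theorem isLawsonUpperSemilattice_of_separated {Z : Type*} [TopologicalSpace Z] [T2Space Z]
    [CompactSpace Z] [SemilatticeSup Z] [ClosedIicTopology Z]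
    (hsep : ∀ x y : Z, ¬ x ≤ y → ∃ m, ¬ x ≤ m ∧ ∀ z ≤ y, Iic m ∈ 𝓝 z)
    {σ : Hyp Z → Z} (hσ : ∀ K : Hyp Z, IsLUB (K : Set Z) (σ K)) :
    IsLawsonUpperSemilattice Z where
  t2 := inferInstance
  continuous_sup := ⟨by
    have h : Continuous fun p : Z × Z => σ ({p.1} ⊔ {p.2}) := by
      refine (continuous_of_isLUB hsep hσ).comp ?_
      exact (NonemptyCompacts.continuous_singleton.comp continuous_fst).sup
        (NonemptyCompacts.continuous_singleton.comp continuous_snd)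
    convert h using 2 with p
    refine IsLUB.unique ?_ (hσ _)
    exact coe_singleton_sup_singleton p.1 p.2 ▸ isLUB_pair⟩
  small p U hU := by
    -- Both `Iic m` and its complement are sup-closed, and they separate `p` from each point outside
    -- the interior of `U`; a finite intersection of such sets suffices.
    have key : ∃ V ∈ 𝓝 p, Disjoint V (interior U)ᶜ ∧ SupClosed V := by
      refine (isOpen_interior (s := U)).isClosed_compl.isCompact.induction_on
        (p := fun s => ∃ V ∈ 𝓝 p, Disjoint V s ∧ SupClosed V) ?_ ?_ ?_ ?_
      · exact ⟨univ, univ_mem, disjoint_empty _, supClosed_univ⟩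
      · rintro s t hst ⟨V, hV, hd, hs⟩
        exact ⟨V, hV, hd.mono_right hst, hs⟩
      · rintro s t ⟨V, hV, hd, hs⟩ ⟨V', hV', hd', hs'⟩
        exact ⟨V ∩ V', inter_mem hV hV', disjoint_union_right.2
          ⟨hd.mono_left inter_subset_left, hd'.mono_left inter_subset_right⟩, hs.inter hs'⟩
      · intro q hq
        have hpq : p ≠ q := fun h => hq (mem_interior_iff_mem_nhds.2 (h ▸ hU))
        by_cases hle : q ≤ p
        · obtain ⟨m, hm, hnhds⟩ := hsep p q fun h => hpq (le_antisymm h hle)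
          refine ⟨Iic m, mem_nhdsWithin_of_mem_nhds (hnhds q le_rfl), (Iic m)ᶜ,
            isClosed_Iic.isOpen_compl.mem_nhds hm, disjoint_compl_left, ?_⟩
          exact fun a ha b _ hab => ha (le_sup_left.trans hab)
        · obtain ⟨m, hm, hnhds⟩ := hsep q p hle
          exact ⟨(Iic m)ᶜ, mem_nhdsWithin_of_mem_nhds (isClosed_Iic.isOpen_compl.mem_nhds hm),
            Iic m, hnhds p le_rfl, disjoint_compl_right, fun a ha b hb => sup_le ha hb⟩
    obtain ⟨V, hV, hd, hs⟩ := key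
    exact ⟨V, hV, (disjoint_compl_right_iff_subset.1 hd).trans interior_subset, hs⟩

end OrderedSpace

namespace StrictAmb

/-! ### Separating representations -/

section Barrier

variable {L : Type w} {X : Type u} {Y : Type v}
  [TopologicalSpace L] [DistribLattice L] [BoundedOrder L] [OrderClosedTopology L]
  [TopologicalSpace X] [TopologicalSpace Y] [CompactSpace Y] [Nonempty Y]

/-- The largest representation whose values at the pairs `(A, B)` with `A ∈ O` and `B ⊆ V` are
at most `v`. -/
def barrier {O : Set (Hyp X)} (hO : IsOpen O) {V : Set Y} (hV : IsOpen V) (hne : V ≠ univ)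
    (v : L) : StrictAmb L X Y where
  carrier := {t | (t.2.1 : Set Y) ⊆ V → (∃ D ∈ O, (D : Set X) ⊆ t.1) → t.2.2 ≤ v}
  mono := fun _ _ _ _ _ _ hA hB hα h hBV ⟨D, hD, hDA⟩ =>
    hα.trans (h (hB.trans hBV) ⟨D, hD, hDA.trans hA⟩)
  sup_mem := fun _ _ _ _ hα hβ hBV hD => sup_le (hα hBV hD) (hβ hBV hD)
  top_mem := fun _ _ h => absurd (univ_subset_iff.1 h) hne
  bot_mem := fun _ _ _ _ => bot_le
  closed_right A := isClosed_imp
    ((NonemptyCompacts.isOpen_subsets_of_isOpen hV).preimage continuous_fst)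
    (isClosed_imp (isOpen_const (p := ∃ D ∈ O, (D : Set X) ⊆ A))
      (isClosed_Iic.preimage continuous_snd))
  closed_left B := isClosed_imp (isOpen_const (p := (B : Set Y) ⊆ V))
    (isClosed_imp ((isOpen_exists_subset hO).preimage continuous_fst)
      (isClosed_Iic.preimage continuous_snd))

theorem mem_barrier {O : Set (Hyp X)} {hO : IsOpen O} {V : Set Y} {hV : IsOpen V}
    {hne : V ≠ univ} {v α : L} {A : Hyp X} {B : Hyp Y} :
    (A, B, α) ∈ (barrier hO hV hne v).carrier ↔
      ((B : Set Y) ⊆ V → (∃ D ∈ O, (D : Set X) ⊆ A) → α ≤ v) :=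
  Iff.rfl

variable [CompactSpace L] [T2Space Y]

theorem closedIicTopology (hL : RaneySeparated L) : ClosedIicTopology (StrictAmb L X Y) where
  isClosed_Iic M := by
    have : Iic M = {R : StrictAmb L X Y | R.cup ⊆ M.cup} := by ext; exact le_iff_cup_subset
    rw [this]
    exact ⟨_, (M.isClosed_cup hL).powerset_vietoris.isOpen_compl, rfl⟩

/-- Some thickening `(N, C)` of `({A}, B)` still has `(N, C, u) ∉ P.cup`. Avoiding this one triple
is an open condition that holds for all `Q ≤ P`, and it forces values at most `v` on the interiors
of `N` and `C`, that is, lying below the barrier. -/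
theorem exists_separating [CompactSpace X] [T2Space X] (hL : RaneySeparated L) (R P : StrictAmb L X Y) (h : ¬ R ≤ P) :
    ∃ M, ¬ R ≤ M ∧ ∀ Q ≤ P, Iic M ∈ 𝓝 Q := by
  obtain ⟨⟨A, B, α⟩, hR, hP⟩ := not_subset.1 h
  obtain ⟨u, v, hu, hv, huv⟩ := hL _ _ (mem_carrier_iff_le_val.not.1 hP)
  have hnhds : P.cupᶜ ∈ 𝓝 (({A} : Hyp (Hyp X)), B, u) :=
    (P.isClosed_cup hL).isOpen_compl.mem_nhds (mem_cup.not.2 hu)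
  obtain ⟨U, hU, W, hW, hUW⟩ := mem_nhds_prod_iff.1 hnhds
  obtain ⟨V, hV, G, hG, hVG⟩ := mem_nhds_prod_iff.1 hW
  obtain ⟨N, hAN, hNU⟩ := exists_thickening_mem hU
  obtain ⟨C, hBC, hCV⟩ := exists_thickening_mem hV
  have hmem : (N, C, u) ∉ P.cup :=
    hUW (mk_mem_prod hNU (hVG (mk_mem_prod hCV (mem_of_mem_nhds hG))))
  have hne : interior (C : Set Y) ≠ univ := fun h => hmem (mem_cup.2 (by
    have : C = ⊤ := SetLike.coe_injective (univ_subset_iff.1 (h ▸ interior_subset))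
    rw [this, val_top]
    exact le_top))
  refine ⟨barrier (isOpen_interior (s := (N : Set (Hyp X)))) isOpen_interior hne v, fun hle => hv ?_, fun Q hQ => ?_⟩
  · exact mem_barrier.1 (hle hR) hBC ⟨A, hAN (by simp), Subset.rfl⟩
  · have hQ' : Q.cup ⊆ {(N, C, u)}ᶜ := fun t ht hteq =>
      hmem (hteq ▸ le_iff_cup_subset.1 hQ ht)
    refine mem_of_superset ((isOpen_cup_subset isClosed_singleton.isOpen_compl).mem_nhds hQ') ?_
    rintro Q' hQ' ⟨A', B', α'⟩ hα'
    refine mem_barrier.2 fun hB' ⟨D, hD, hDA⟩ => ?_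
    refine (huv α').resolve_left fun huα => hQ' (mem_cup.2 ?_) rfl
    exact huα.trans (le_val (interior_subset hD)
      (Q'.mono _ _ _ _ _ _ hDA (hB'.trans interior_subset) le_rfl hα'))

end Barrier

/-! ### Suprema of compact families -/

section Supremum

variable {L : Type w} {X : Type u} {Y : Type v}
  [TopologicalSpace L] [DistribLattice L] [BoundedOrder L] [CompactSpace L] [OrderClosedTopology L]
  [TopologicalSpace X] [TopologicalSpace Y] [CompactSpace Y] [Nonempty Y]

/-- The pointwise supremum of a family of representations. -/
noncomputable def familyVal (𝓡 : Set (StrictAmb L X Y)) (A : Hyp X) (B : Hyp Y) : L :=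
  Classical.choose (exists_isLUB_of_compactSpace {α : L | ∃ R ∈ 𝓡, (A, B, α) ∈ R.carrier})

variable {𝓡 : Set (StrictAmb L X Y)} {A : Hyp X} {B : Hyp Y} {α b : L}

theorem isLUB_familyVal (𝓡 : Set (StrictAmb L X Y)) (A : Hyp X) (B : Hyp Y) :
    IsLUB {α : L | ∃ R ∈ 𝓡, (A, B, α) ∈ R.carrier} (familyVal 𝓡 A B) :=
  Classical.choose_spec
    (exists_isLUB_of_compactSpace {α : L | ∃ R ∈ 𝓡, (A, B, α) ∈ R.carrier})

theorem le_familyVal {R : StrictAmb L X Y} (hR : R ∈ 𝓡) (h : (A, B, α) ∈ R.carrier) :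
    α ≤ familyVal 𝓡 A B :=
  (isLUB_familyVal 𝓡 A B).1 ⟨R, hR, h⟩

theorem familyVal_le_iff :
    familyVal 𝓡 A B ≤ b ↔ ∀ R ∈ 𝓡, ∀ α, (A, B, α) ∈ R.carrier → α ≤ b := by
  rw [isLUB_le_iff (isLUB_familyVal 𝓡 A B)]
  exact ⟨fun h A hA α hα => h ⟨A, hA, hα⟩, fun h α ⟨A, hA, hα⟩ => h A hA α hα⟩

variable [CompactSpace X] [T2Space X] [T2Space Y]

theorem isClosed_setOf_mem_cup (hL : RaneySeparated L) :
    IsClosed {p : StrictAmb L X Y × (Hyp (Hyp X) × Hyp Y × L) | p.2 ∈ p.1.cup} := by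
  rw [← isOpen_compl_iff, isOpen_iff_mem_nhds]
  rintro ⟨R, t⟩ ht
  obtain ⟨K, ⟨hK, hKc⟩, hKR⟩ := (closed_nhds_basis t).mem_iff.1
    ((R.isClosed_cup hL).isOpen_compl.mem_nhds ht)
  refine mem_of_superset (prod_mem_nhds ((isOpen_cup_subset hKc.isOpen_compl).mem_nhds
    (subset_compl_comm.1 hKR)) hK) ?_
  rintro ⟨R', t'⟩ ⟨hR', ht'⟩ hmem
  exact hR' hmem ht'

/-- The tube argument for `isClosed_cup` applies again, with the compact family `𝓡` in the role of
`𝒜`. -/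
theorem isClosed_le_familyVal (hL : RaneySeparated L) (h𝓡 : IsCompact 𝓡) :
    IsClosed {t : Hyp X × Hyp Y × L | t.2.2 ≤ familyVal 𝓡 t.1 t.2.1} := by
  rw [← isOpen_compl_iff, isOpen_iff_mem_nhds]
  rintro ⟨A, B, α⟩ h
  obtain ⟨u, v, hu, hv, huv⟩ := hL _ _ h
  have hcl : IsClosed {p : StrictAmb L X Y × (Hyp X × Hyp Y) | (p.2.1, p.2.2, u) ∈ p.1.carrier} := by
    have hf : Continuous fun p : StrictAmb L X Y × (Hyp X × Hyp Y) =>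
        (p.1, ({p.2.1} : Hyp (Hyp X)), p.2.2, u) := by
      refine continuous_fst.prodMk (Continuous.prodMk ?_ (by fun_prop))
      exact NonemptyCompacts.continuous_singleton.comp (by fun_prop)
    convert (isClosed_setOf_mem_cup hL).preimage hf using 1
    ext p
    exact mem_carrier_iff_le_val.trans mem_cup.symm
  obtain ⟨G, V, hG, hV, h𝓡G, hABV, hGV⟩ := generalized_tube_lemma h𝓡
    (isCompact_singleton (x := (A, B))) hcl.isOpen_compl (by
      rintro ⟨R, p⟩ ⟨hR, rfl⟩ hmem
      exact hu (le_familyVal hR hmem))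
  have hcont : Tendsto (fun t : Hyp X × Hyp Y × L => (t.1, t.2.1)) (𝓝 (A, B, α)) (𝓝 (A, B)) :=
    Continuous.tendsto (by fun_prop) _
  have hsnd : Tendsto (fun t : Hyp X × Hyp Y × L => t.2.2) (𝓝 (A, B, α)) (𝓝 α) :=
    Continuous.tendsto (f := fun t : Hyp X × Hyp Y × L => t.2.2) (by fun_prop) _
  filter_upwards [hcont (hV.mem_nhds (hABV rfl)),
    hsnd ((isClosed_Iic (a := v)).isOpen_compl.mem_nhds hv)] with t ht htv hmem
  refine htv (le_trans hmem (familyVal_le_iff.2 fun R hR β hβ => ?_))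
  exact (huv β).resolve_left fun huβ =>
    hGV (mk_mem_prod (h𝓡G hR) ht) (R.mono _ _ _ _ _ _ Subset.rfl Subset.rfl huβ hβ)

/-- The least upper bound of a compact family of representations. -/
def compactSup (hL : RaneySeparated L) (h𝓡 : IsCompact 𝓡) : StrictAmb L X Y :=
  have hcl : IsClosed {t : Hyp X × Hyp Y × L | t.2.1 = ⊤ ∨ t.2.2 ≤ familyVal 𝓡 t.1 t.2.1} :=
    (isClosed_singleton.preimage (continuous_fst.comp continuous_snd)).union
      (isClosed_le_familyVal hL h𝓡)
  -- The clause `t.2.1 = ⊤` matters only for empty `𝓡`: otherwise `familyVal` is already `⊤` there.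
  { carrier := {t | t.2.1 = ⊤ ∨ t.2.2 ≤ familyVal 𝓡 t.1 t.2.1}
    mono := by
      rintro A A' B B' α α' hA hB hα (h | h)
      · exact Or.inl (top_le_iff.1 (h.symm.le.trans hB))
      · exact Or.inr ((hα.trans h).trans (familyVal_le_iff.2 fun R hR β hβ =>
          le_familyVal hR (R.mono _ _ _ _ _ _ hA hB le_rfl hβ)))
    sup_mem := by
      rintro A B α β (h | h) (h' | h')
      · exact Or.inl h
      · exact Or.inl h
      · exact Or.inl h'
      · exact Or.inr (sup_le h h')
    top_mem := fun _ _ => Or.inl rfl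
    bot_mem := fun _ _ => Or.inr bot_le
    closed_right := fun A => hcl.preimage (f := fun p : Hyp Y × L => (A, p.1, p.2)) (by fun_prop)
    closed_left := fun B => hcl.preimage (f := fun p : Hyp X × L => (p.1, B, p.2)) (by fun_prop) }

theorem isLUB_compactSup (hL : RaneySeparated L) (h𝓡 : IsCompact 𝓡) :
    IsLUB 𝓡 (compactSup hL h𝓡) := by
  refine ⟨fun R hR t ht => Or.inr (le_familyVal hR ht), fun S hS => ?_⟩
  rintro ⟨A, B, α⟩ (h | h)
  · obtain rfl : B = ⊤ := h
    exact S.top_mem A α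
  · exact mem_carrier_iff_le_val.2 (h.trans (familyVal_le_iff.2 fun R hR β hβ =>
      mem_carrier_iff_le_val.1 (hS hR hβ)))

theorem compactSup_cup_subset (hL : RaneySeparated L) (h𝓡 : IsCompact 𝓡) :
    (compactSup hL h𝓡).cup ⊆ plusOp (⋃ R ∈ 𝓡, R.cup) := by
  rintro ⟨𝒜, B, γ⟩ hγ
  have hrefl : 𝒜 ∈ refines 𝒜 := fun A hA => ⟨A, hA, Subset.rfl⟩
  by_cases hB : B = ⊤
  · refine ⟨{(𝒜, B, γ)}, isClosed_singleton, singleton_nonempty _, ?_, by simp, by simp, by simp⟩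
    rintro _ rfl
    exact ⟨𝒜, γ, Or.inl (Or.inr hB), hrefl, le_rfl⟩
  -- Only the third coordinate varies in `F`; the point with `⊥` keeps `F` non-empty.
  · let F : Set (Hyp (Hyp X) × Hyp Y × L) :=
      {t | t.1 = 𝒜 ∧ t.2.1 = B ∧ t.2.2 ≤ γ ∧ (t.2.2 = ⊥ ∨ ∃ R ∈ 𝓡, t ∈ R.cup)}
    have hF : IsClosed F := by
      have h1 : IsClosed {t : Hyp (Hyp X) × Hyp Y × L | ∃ R ∈ 𝓡, t ∈ R.cup} := by
        have := (((h𝓡.prod isCompact_univ).inter_right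
          (isClosed_setOf_mem_cup (X := X) (Y := Y) hL)).image continuous_snd).isClosed
        convert this using 1
        ext t
        simp
      exact (isClosed_eq continuous_fst continuous_const).inter
        ((isClosed_eq (continuous_fst.comp continuous_snd) continuous_const).inter
        ((isClosed_Iic.preimage (continuous_snd.comp continuous_snd)).inter
        ((isClosed_eq (continuous_snd.comp continuous_snd) continuous_const).union h1)))
    have hbot : (𝒜, B, ⊥) ∈ F := ⟨rfl, rfl, bot_le, Or.inl rfl⟩
    refine ⟨F, hF, ⟨_, hbot⟩, ?_, ?_, ?_, ?_, ?_⟩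
    · rintro ⟨𝒜', B', α⟩ ⟨rfl, rfl, -, h⟩
      refine ⟨𝒜', α, ?_, hrefl, le_rfl⟩
      rcases h with h | ⟨R, hR, h⟩
      · exact Or.inr h
      · exact Or.inl (Or.inl (mem_biUnion hR h))
    · refine Subset.antisymm (fun A hA => mem_biUnion hbot hA) (iUnion₂_subset fun f hf => ?_)
      rw [hf.1]
    · refine Subset.antisymm (fun A hA => mem_biUnion hbot hA) (iUnion₂_subset fun f hf => ?_)
      rw [hf.2.1]
    · rintro _ ⟨f, hf, rfl⟩
      exact hf.2.2.1
    · intro b hb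
      by_contra hγb
      -- From `γ ≰ v` follows `u ≤ γ`. If no `R.cup` contained `(𝒜, B, u)`, all values would be at
      -- most `v`, forcing `γ ≤ v`.
      obtain ⟨u, v, hu, hv, huv⟩ := hL _ _ hγb
      refine hu (hb ⟨(𝒜, B, u), ⟨rfl, rfl, (huv γ).resolve_right hv, Or.inr ?_⟩, rfl⟩)
      by_contra! hcon
      refine hv ((mem_cup.1 hγ).trans (val_le_iff.2 fun A hA α hα => ?_))
      refine (hα.resolve_left hB).trans (familyVal_le_iff.2 fun R hR β hβ => ?_)
      exact (huv β).resolve_left fun huβ => hcon R hR (mem_cup.2 (huβ.trans (le_val hA hβ)))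

/-- Values of the supremum dominate those of each member and only grow under refinement of `𝒜` and
enlargement of `𝒜` or `B`, so they bound every element of `F`. -/
theorem plusOp_subset_compactSup_cup (hL : RaneySeparated L) (h𝓡 : IsCompact 𝓡) :
    plusOp (⋃ R ∈ 𝓡, R.cup) ⊆ (compactSup hL h𝓡).cup := by
  rintro ⟨𝒜, B, γ⟩ ⟨F, -, -, hF, h𝒜, hB, hγ⟩
  refine mem_cup.2 ((isLUB_le_iff hγ).2 ?_)
  rintro _ ⟨f, hf, rfl⟩
  obtain ⟨𝒞, α, hα, href, hle⟩ := hF hf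
  have hval : α ≤ (compactSup hL h𝓡).val 𝒞 f.2.1 := by
    rcases hα with (hα | hα) | hα
    · obtain ⟨R, hR, hα⟩ := mem_iUnion₂.1 hα
      exact (mem_cup.1 hα).trans (val_le_val_of_le ((isLUB_compactSup hL h𝓡).1 hR))
    · have : f.2.1 = ⊤ := hα
      rw [this, val_top]
      exact le_top
    · exact le_of_eq_of_le hα bot_le
  refine (hle.trans hval).trans (val_le_val (fun A hA => ?_) ?_)
  · obtain ⟨D, hD, hDA⟩ := href A hA
    exact ⟨D, h𝒜.superset (mem_biUnion hf hD), hDA⟩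
  · exact (subset_biUnion_of_mem (u := fun f : Hyp (Hyp X) × Hyp Y × L => (f.2.1 : Set Y)) hf).trans
      hB.superset

end Supremum

end StrictAmb

end Development

end AmbRep

theorem mainTheorem2 {L : Type*} {X : Type*} {Y : Type*}
    [TopologicalSpace L] [DistribLattice L] [BoundedOrder L] [CompactSpace L]
    (hL : AmbRep.IsLawsonLattice L)
    [TopologicalSpace X] [CompactSpace X] [T2Space X] [Nonempty X]
    [TopologicalSpace Y] [CompactSpace Y] [T2Space Y] [Nonempty Y] :
    -- the sets `R^∪` are closed; `R ↦ R^∪` maps into the hyperspace, is injective with closed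
    -- image, and is an embedding for the topology on `Csamb_L(X,Y)`
    (∀ R : AmbRep.StrictAmb L X Y, IsClosed R.cup) ∧
    (∃ e : AmbRep.StrictAmb L X Y →
        AmbRep.Hyp (AmbRep.Hyp (AmbRep.Hyp X) × AmbRep.Hyp Y × L),
      (∀ R, (e R : Set (AmbRep.Hyp (AmbRep.Hyp X) × AmbRep.Hyp Y × L)) = R.cup) ∧
      Function.Injective e ∧ IsClosed (Set.range e) ∧ IsEmbedding e) ∧
    -- the topology is compact Hausdorff
    CompactSpace (AmbRep.StrictAmb L X Y) ∧ T2Space (AmbRep.StrictAmb L X Y) ∧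
    -- the order corresponds to the inclusion of the sets `R^∪`, is closed, and a family has the
    -- same supremum as its closure
    (∀ R S : AmbRep.StrictAmb L X Y, R ≤ S ↔ R.cup ⊆ S.cup) ∧
    IsClosed {p : AmbRep.StrictAmb L X Y × AmbRep.StrictAmb L X Y | p.1 ≤ p.2} ∧
    (∀ (𝓡 : Set (AmbRep.StrictAmb L X Y)) (S : AmbRep.StrictAmb L X Y),
      IsLUB 𝓡 S ↔ IsLUB (closure 𝓡) S) ∧
    -- each closed family has a supremum, which is given by the formula
    (∀ 𝓡 : Set (AmbRep.StrictAmb L X Y), IsClosed 𝓡 →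
      ∃ S : AmbRep.StrictAmb L X Y, IsLUB 𝓡 S ∧ S.cup = AmbRep.plusOp (⋃ R ∈ 𝓡, R.cup)) ∧
    -- the supremum depends continuously on the (closed non-empty) family
    (∃ σ : AmbRep.Hyp (AmbRep.StrictAmb L X Y) → AmbRep.StrictAmb L X Y,
      Continuous σ ∧ ∀ 𝓡 : AmbRep.Hyp (AmbRep.StrictAmb L X Y),
        IsLUB (𝓡 : Set (AmbRep.StrictAmb L X Y)) (σ 𝓡)) ∧
    -- `Csamb_L(X,Y)`, ordered by inclusion, is a Lawson upper semilattice
    (∃ inst : SemilatticeSup (AmbRep.StrictAmb L X Y),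
      inst.toPartialOrder = AmbRep.StrictAmb.instPartialOrder ∧
      AmbRep.IsLawsonUpperSemilattice (AmbRep.StrictAmb L X Y)) := by
  
  obtain ⟨t2L, latL, small_sup, small_inf⟩ := hL
  have : OrderClosedTopology L := AmbRep.orderClosedTopology_of_continuousInf
  have hR : AmbRep.RaneySeparated L := AmbRep.raneySeparated_of_small small_sup small_inf
  have hcompact : CompactSpace (AmbRep.StrictAmb L X Y) := AmbRep.StrictAmb.compactSpace hR
  have ht2 : T2Space (AmbRep.StrictAmb L X Y) := AmbRep.StrictAmb.t2Space hR
  have hIic : ClosedIicTopology (AmbRep.StrictAmb L X Y) := AmbRep.StrictAmb.closedIicTopology hR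
  have hsep := AmbRep.StrictAmb.exists_separating (X := X) (Y := Y) hR
  have hord : OrderClosedTopology (AmbRep.StrictAmb L X Y) :=
    AmbRep.orderClosedTopology_of_separated hsep
  have hemb := AmbRep.StrictAmb.isEmbedding_cupHyp (X := X) (Y := Y) hR
  let σ : AmbRep.Hyp (AmbRep.StrictAmb L X Y) → AmbRep.StrictAmb L X Y :=
    fun 𝓡 => AmbRep.StrictAmb.compactSup hR 𝓡.isCompact
  have hσ : ∀ 𝓡 : AmbRep.Hyp (AmbRep.StrictAmb L X Y),
      IsLUB (𝓡 : Set (AmbRep.StrictAmb L X Y)) (σ 𝓡) :=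
    fun 𝓡 => AmbRep.StrictAmb.isLUB_compactSup hR 𝓡.isCompact
  refine ⟨fun R => R.isClosed_cup hR, ⟨AmbRep.StrictAmb.cupHyp hR, fun _ => rfl, hemb.injective,
    (isCompact_range hemb.continuous).isClosed, hemb⟩, hcompact, ht2,
    fun R S => AmbRep.StrictAmb.le_iff_cup_subset, hord.isClosed_le', fun 𝓡 S => ?_,
    fun 𝓡 h𝓡 => ⟨_, AmbRep.StrictAmb.isLUB_compactSup hR h𝓡.isCompact,
      Set.Subset.antisymm (AmbRep.StrictAmb.compactSup_cup_subset hR h𝓡.isCompact)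
        (AmbRep.StrictAmb.plusOp_subset_compactSup_cup hR h𝓡.isCompact)⟩,
    ⟨σ, AmbRep.continuous_of_isLUB hsep hσ, hσ⟩, ?_⟩
  -- As each `Iic S` is closed, a family and its closure have the same upper bounds.
  · simp only [IsLUB, upperBounds_closure]
  · have hpair : ∀ R S : AmbRep.StrictAmb L X Y, IsLUB {R, S} (σ ({R} ⊔ {S})) := fun R S => 
      AmbRep.coe_singleton_sup_singleton R S ▸ hσ ({R} ⊔ {S})
    let inst : SemilatticeSup (AmbRep.StrictAmb L X Y) :=
      { AmbRep.StrictAmb.instPartialOrder with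
        sup := fun R S => σ ({R} ⊔ {S})
        le_sup_left := fun R S => (hpair R S).1 (by simp)
        le_sup_right := fun R S => (hpair R S).1 (by simp)
        sup_le := fun R S T hRT hST => (hpair R S).2 (by simp [hRT, hST]) }
    exact ⟨inst, rfl, AmbRep.isLawsonUpperSemilattice_of_separated hsep hσ⟩
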